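/- Let $d\ge 1$, let $H\in[1/2,1)$ be a Hurst index, and let $f$ be either the Riesz kernel of order $\alpha$ on $\mathbb R^d$ with $0<\alpha<d$, $$f(x)=\frac{\Gamma((d-\alpha)/2)}{2^{\alpha}\pi^{d/2}\Gamma(\alpha/2)}\,|x|^{-d+\alpha},$$ or the Bessel kernel of order $\alpha>0$, $$f(x)=\frac{1}{(4\pi)^{d/2}\Gamma(\alpha/2)}\int_0^\infty w^{(\alpha-d)/2-1}e^{-w}e^{-|x|^2/(4w)}\,dw .$$ Let $\mathcal{HP}$ be the Hilbert space completion of the linear span of the indicators $1_{[0,t]\times A}$ ($t\ge 0$, $A\subset\mathbb R^d$ bounded Borel) with respect to the inner product determined by $$\langle 1_{[0,t]\times A},1_{[0,s]\times B}\rangle_{\mathcal{HP}}=H(2H-1)\int_0^t\!\int_0^s\!\int_A\!\int_B|u-v|^{2H-2}f(x-y)\,dy\,dx\,dv\,du\quad\text{if }H>1/2,$$ and $(t\wedge s)\int_A\int_B f(x-y)\,dy\,dx$ if $H=1/2$. Let $W=\{W(h);h\in\mathcal{HP}\}$ be a zero-mean Gaussian process on a probability space, with covariance $E(W(h)W(g))=\langle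 h,g\rangle_{\mathcal{HP}}$, let $\mathcal F_t$ be the $\sigma$-field generated by the $W(1_{[0,s]\times A})$ with $s\in[0,t]$ and $A$ bounded Borel, and let $p_t(x)=(2\pi t)^{-d/2}e^{-|x|^2/(2t)}$. Consider the stochastic heat equation $$\frac{\partial u}{\partial t}=\frac12\Delta u+u\,\dot W,\qquad t>0,\ x\in\mathbb R^d,\qquad u_{0,x}=1 .$$ A solution in $\mathbb R_+\times\mathbb R^d$ is an $(\mathcal F_t)$-adapted square-integrable process $u=\{u_{t,x};(t,x)\in\mathbb R_+\times\mathbb R^d\}$ such that, for every $(t,x)\in\mathbb R_+\times\mathbb R^d$, the process $Y^{t,x}_{s,y}=1_{[0,t]}(s)\,p_{t-s}(x-y)\,u_{s,y}$ is integrable with respect to $W$ in the sense of Skorohod, i.e. it lies in the domain, contained in $L^2(\Omega;\mathcal{HP})$, of the adjoint $\delta$ of the Malliavin derivative, and $u_{t,x}=1+\delta(Y^{t,x})$ almost surely. If this equation has a solution in $\mathbb R_+\times\mathbb R^d$, then $$H>\frac{d-\alpha}{4},\qquad\text{i.e. } d<4H+\alpha .$$ -/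

import Mathlib

open MeasureTheory ProbabilityTheory
open scoped InnerProductSpace NNReal ENNReal

namespace FracHeat

/-- Bounded Borel sets. -/
abbrev BddBorel (E : Type) [MeasurableSpace E] [Bornology E] : Type :=
  {A : Set E // MeasurableSet A ∧ Bornology.IsBounded A}

/-! ### Positive definiteness of Gaussian mixtures -/

theorem posSemidef_of_integral {ι X : Type*} [MeasurableSpace X] (ν : Measure X)
    (N : X → Matrix ι ι ℝ) (hN : ∀ᵐ w ∂ν, (N w).PosSemidef)
    (hint : ∀ i j, Integrable (fun w => N w i j) ν) :
    (Matrix.of fun i j => ∫ w, N w i j ∂ν).PosSemidef := by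
  refine ⟨?_, fun x => ?_⟩
  · ext i j
    simp only [Matrix.conjTranspose_apply, Matrix.of_apply, star_trivial]
    refine integral_congr_ae ?_
    filter_upwards [hN] with w hw
    simpa using hw.1.apply i j
  · have h : (x.sum fun i xi => x.sum fun j xj =>
        star xi * (Matrix.of fun i j => ∫ w, N w i j ∂ν) i j * xj) =
        ∫ w, (x.sum fun i xi => x.sum fun j xj => star xi * N w i j * xj) ∂ν := by
      simp only [Finsupp.sum, Matrix.of_apply]
      rw [integral_finsetSum _ fun i _ => integrable_finsetSum _ fun j _ =>
        ((hint i j).const_mul _).mul_const _]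
      refine Finset.sum_congr rfl fun i _ => ?_
      rw [integral_finsetSum _ fun j _ => ((hint i j).const_mul _).mul_const _]
      refine Finset.sum_congr rfl fun j _ => ?_
      rw [integral_mul_const, integral_const_mul]
    rw [h]
    refine integral_nonneg_of_ae ?_
    filter_upwards [hN] with w hw using hw.2 x

theorem posSemidef_mul_self {ι : Type*} (a : ι → ℝ) :
    (Matrix.of fun i j => a i * a j).PosSemidef := by
  refine ⟨by ext i j; simp [mul_comm], fun x => ?_⟩
  have h : (x.sum fun i xi => x.sum fun j xj =>
      star xi * (Matrix.of fun i j => a i * a j) i j * xj) = (x.sum fun i xi => xi * a i) ^ 2 := by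
    simp only [Finsupp.sum, Matrix.of_apply, star_trivial, sq, Finset.sum_mul_sum]
    exact Finset.sum_congr rfl fun i _ => Finset.sum_congr rfl fun j _ => by ring
  rw [h]
  exact sq_nonneg _

section Mixture

variable {E : Type} [NormedAddCommGroup E] [InnerProductSpace ℝ E] [FiniteDimensional ℝ E]
  [MeasurableSpace E] [BorelSpace E] (μ : Measure E) [μ.IsAddHaarMeasure]

theorem exp_neg_eq_integral_cos {b : ℝ} (hb : 0 ≤ b) (x : E) :
    Real.exp (-b * ‖x‖ ^ 2) = ∫ ξ, Real.cos (√(2 * b) * ⟪ξ, x⟫_ℝ) ∂(stdGaussian E) := by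
  have h := charFun_stdGaussian (√(2 * b) • x)
  rw [charFun_apply] at h
  have h2 := congrArg Complex.re h
  have hi : Integrable (fun ξ : E => Complex.exp (⟪ξ, √(2 * b) • x⟫_ℝ * Complex.I))
      (stdGaussian E) := by
    refine Integrable.of_bound (C := 1) (by fun_prop) (Filter.Eventually.of_forall fun ξ => ?_)
    rw [Complex.norm_exp_ofReal_mul_I]
  have h3 := integral_re hi
  simp only [RCLike.re_to_complex] at h3
  rw [← h3] at h2
  simp only [Complex.exp_ofReal_mul_I_re, inner_smul_right] at h2
  rw [h2, ← Complex.ofReal_pow, ← Complex.ofReal_neg, norm_smul, mul_pow, Real.norm_eq_abs, sq_abs,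
    Real.sq_sqrt (by positivity)]
  rw [show ((-(2 * b * ‖x‖ ^ 2) : ℝ) : ℂ) / 2 = ((-b * ‖x‖ ^ 2 : ℝ) : ℂ) by push_cast; ring]
  rw [Complex.exp_ofReal_re]

theorem gaussian_posSemidef {b : ℝ} (hb : 0 ≤ b) :
    (Matrix.of fun A B : BddBorel E =>
      ∫ x in A.1, ∫ y in B.1, Real.exp (-b * ‖x - y‖ ^ 2) ∂μ ∂μ).PosSemidef := by
  set s := √(2 * b)
  have hfin : ∀ A : BddBorel E, IsFiniteMeasure (μ.restrict A.1) := fun A =>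
    ⟨by rw [Measure.restrict_apply_univ]; exact A.2.2.measure_lt_top⟩
  let C : E → BddBorel E → ℝ := fun ξ A => ∫ x in A.1, Real.cos (s * ⟪ξ, x⟫_ℝ) ∂μ
  let S : E → BddBorel E → ℝ := fun ξ A => ∫ x in A.1, Real.sin (s * ⟪ξ, x⟫_ℝ) ∂μ
  have hc : ∀ (A : BddBorel E) ξ, Integrable (fun x => Real.cos (s * ⟪ξ, x⟫_ℝ)) (μ.restrict A.1) :=
    fun A ξ => Integrable.of_bound (C := 1) (by fun_prop)
      (Filter.Eventually.of_forall fun x => Real.abs_cos_le_one _)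
  have hs : ∀ (A : BddBorel E) ξ, Integrable (fun x => Real.sin (s * ⟪ξ, x⟫_ℝ)) (μ.restrict A.1) :=
    fun A ξ => Integrable.of_bound (C := 1) (by fun_prop)
      (Filter.Eventually.of_forall fun x => Real.abs_sin_le_one _)
  have key : ∀ A B : BddBorel E,
      Integrable (fun ξ => C ξ A * C ξ B + S ξ A * S ξ B) (stdGaussian E) ∧
      ∫ x in A.1, ∫ y in B.1, Real.exp (-b * ‖x - y‖ ^ 2) ∂μ ∂μ =
        ∫ ξ, (C ξ A * C ξ B + S ξ A * S ξ B) ∂(stdGaussian E) := by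
    intro A B
    have h1 : ∀ ξ, C ξ A * C ξ B + S ξ A * S ξ B =
        ∫ p, Real.cos (s * ⟪ξ, p.1 - p.2⟫_ℝ) ∂((μ.restrict A.1).prod (μ.restrict B.1)) := by
      intro ξ
      simp only [C, S]
      rw [← integral_prod_mul, ← integral_prod_mul, ← integral_add]
      · refine integral_congr_ae (Filter.Eventually.of_forall fun p => ?_)
        simp only [inner_sub_right, mul_sub, Real.cos_sub]
      · exact (hc A ξ).mul_prod (hc B ξ)
      · exact (hs A ξ).mul_prod (hs B ξ)
    have hI : Integrable (Function.uncurry fun (ξ : E) (p : E × E) =>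
        Real.cos (s * ⟪ξ, p.1 - p.2⟫_ℝ))
        ((stdGaussian E).prod ((μ.restrict A.1).prod (μ.restrict B.1))) :=
      Integrable.of_bound (C := 1) (by simp only [Function.uncurry_def]; fun_prop)
        (Filter.Eventually.of_forall fun x => Real.abs_cos_le_one _)
    constructor
    · simp only [h1]
      exact hI.integral_prod_left
    · simp only [h1]
      rw [integral_integral_swap hI]
      simp only [exp_neg_eq_integral_cos hb]
      rw [integral_integral (f := fun x y => ∫ ξ, Real.cos (s * ⟪ξ, x - y⟫_ℝ) ∂(stdGaussian E))]
      exact hI.integral_prod_right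
  have h := posSemidef_of_integral (stdGaussian E)
    (fun ξ => Matrix.of (fun A B => C ξ A * C ξ B) + Matrix.of (fun A B => S ξ A * S ξ B))
    (Filter.Eventually.of_forall fun ξ =>
      (posSemidef_mul_self (C ξ)).add (posSemidef_mul_self (S ξ)))
    (fun A B => (key A B).1)
  have e : (Matrix.of fun A B : BddBorel E =>
      ∫ x in A.1, ∫ y in B.1, Real.exp (-b * ‖x - y‖ ^ 2) ∂μ ∂μ) = _ :=
    Matrix.ext fun A B => (key A B).2
  rw [e]
  exact h

theorem integrable_sub_prod {f : E → ℝ} (hf : LocallyIntegrable f μ) (A B : BddBorel E) :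
    Integrable (fun p : E × E => f (p.1 - p.2)) ((μ.restrict A.1).prod (μ.restrict B.1)) := by
  obtain ⟨R, hR⟩ := (A.2.2.sub B.2.2).subset_closedBall 0
  have h1 : Integrable ((Metric.closedBall (0 : E) R).indicator f) μ :=
    (hf.integrableOn_isCompact (isCompact_closedBall _ _)).integrable_indicator
      measurableSet_closedBall
  have h2 : Integrable (B.1.indicator fun _ => (1 : ℝ)) μ :=
    (integrable_indicator_iff B.2.1).2 (integrableOn_const B.2.2.measure_lt_top.ne)
  have h3 := (measurePreserving_sub_prod μ μ).integrable_comp_of_integrable (h1.mul_prod h2)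
  rw [Measure.prod_restrict]
  refine (h3.restrict (s := A.1 ×ˢ B.1)).congr ?_
  filter_upwards [ae_restrict_mem (A.2.1.prod B.2.1)] with p hp
  have : p.1 - p.2 ∈ Metric.closedBall (0 : E) R := hR (Set.sub_mem_sub hp.1 hp.2)
  simp [Set.indicator_of_mem this, Set.indicator_of_mem hp.2]

/-- Positive definiteness of a nonnegative mixture of Gaussian kernels. -/
theorem mixture_posSemidef {f : E → ℝ} (hf : LocallyIntegrable f μ) (b m : ℝ → ℝ)
    (hbm : Measurable b) (hmm : Measurable m) (hb : ∀ w ∈ Set.Ioi (0 : ℝ), 0 ≤ b w)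
    (hm : ∀ w ∈ Set.Ioi (0 : ℝ), 0 ≤ m w)
    (hfi : ∀ᵐ x ∂μ, IntegrableOn (fun w => m w * Real.exp (-b w * ‖x‖ ^ 2)) (Set.Ioi 0))
    (hfe : ∀ᵐ x ∂μ, f x = ∫ w in Set.Ioi (0 : ℝ), m w * Real.exp (-b w * ‖x‖ ^ 2)) :
    (Matrix.of fun A B : BddBorel E => ∫ x in A.1, ∫ y in B.1, f (x - y) ∂μ ∂μ).PosSemidef := by
  have hfin : ∀ A : BddBorel E, IsFiniteMeasure (μ.restrict A.1) := fun A =>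
    ⟨by rw [Measure.restrict_apply_univ]; exact A.2.2.measure_lt_top⟩
  have hq : Measure.QuasiMeasurePreserving (fun p : E × E => p.1 - p.2) (μ.prod μ) μ :=
    Measure.quasiMeasurePreserving_fst.comp (measurePreserving_sub_prod μ μ).quasiMeasurePreserving
  have key : ∀ A B : BddBorel E,
      Integrable (fun w => m w * ∫ x in A.1, ∫ y in B.1, Real.exp (-b w * ‖x - y‖ ^ 2) ∂μ ∂μ)
        (volume.restrict (Set.Ioi 0)) ∧
      ∫ x in A.1, ∫ y in B.1, f (x - y) ∂μ ∂μ =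
        ∫ w in Set.Ioi (0 : ℝ),
          m w * ∫ x in A.1, ∫ y in B.1, Real.exp (-b w * ‖x - y‖ ^ 2) ∂μ ∂μ := by
    intro A B
    set π := (μ.restrict A.1).prod (μ.restrict B.1) with hπ
    have hac : π ≪ μ.prod μ := by
      rw [hπ, Measure.prod_restrict]; exact Measure.absolutelyContinuous_of_le Measure.restrict_le_self
    have hfi' := hac.ae_le (hq.ae hfi)
    have hfe' := hac.ae_le (hq.ae hfe)
    have hI : Integrable (fun q : (E × E) × ℝ => m q.2 * Real.exp (-b q.2 * ‖q.1.1 - q.1.2‖ ^ 2))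
        (π.prod (volume.restrict (Set.Ioi 0))) := by
      rw [integrable_prod_iff (by fun_prop)]
      refine ⟨hfi', (integrable_sub_prod μ hf A B).congr ?_⟩
      filter_upwards [hfe'] with p hp
      rw [hp]
      refine setIntegral_congr_fun measurableSet_Ioi fun w hw => ?_
      rw [Real.norm_of_nonneg (mul_nonneg (hm w hw) (Real.exp_pos _).le)]
    have hg : ∀ w ∈ Set.Ioi (0 : ℝ),
        ∫ p, m w * Real.exp (-b w * ‖p.1 - p.2‖ ^ 2) ∂π =
        m w * ∫ x in A.1, ∫ y in B.1, Real.exp (-b w * ‖x - y‖ ^ 2) ∂μ ∂μ := by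
      intro w hw
      rw [integral_const_mul, integral_integral (f := fun x y => Real.exp (-b w * ‖x - y‖ ^ 2))]
      refine Integrable.of_bound (C := 1) (by fun_prop) (Filter.Eventually.of_forall fun p => ?_)
      simp only [Function.uncurry]
      rw [Real.norm_of_nonneg (Real.exp_pos _).le, Real.exp_le_one_iff]
      nlinarith [hb w hw, sq_nonneg ‖p.1 - p.2‖, mul_nonneg (hb w hw) (sq_nonneg ‖p.1 - p.2‖)]
    constructor
    · refine hI.integral_prod_right.congr ?_
      filter_upwards [ae_restrict_mem measurableSet_Ioi] with w hw using hg w hw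
    · rw [integral_integral (f := fun x y => f (x - y)) (integrable_sub_prod μ hf A B)]
      rw [integral_congr_ae hfe', integral_integral_swap
        (f := fun (p : E × E) w => m w * Real.exp (-b w * ‖p.1 - p.2‖ ^ 2)) hI]
      exact setIntegral_congr_fun measurableSet_Ioi hg
  have e : (Matrix.of fun A B : BddBorel E => ∫ x in A.1, ∫ y in B.1, f (x - y) ∂μ ∂μ) =
      Matrix.of fun A B => ∫ w in Set.Ioi (0 : ℝ), (m w • Matrix.of fun A B : BddBorel E =>
        ∫ x in A.1, ∫ y in B.1, Real.exp (-b w * ‖x - y‖ ^ 2) ∂μ ∂μ) A B := by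
    ext A B
    simpa using (key A B).2
  rw [e]
  refine posSemidef_of_integral _ _ ?_ fun A B => ?_
  · filter_upwards [ae_restrict_mem measurableSet_Ioi] with w hw
    exact (gaussian_posSemidef μ (hb w hw)).smul (hm w hw)
  · simpa using (key A B).1

end Mixture

section Kernels

variable {E : Type} [NormedAddCommGroup E] [InnerProductSpace ℝ E] [FiniteDimensional ℝ E]
  [MeasurableSpace E] [BorelSpace E]

theorem locallyIntegrable_norm_rpow [Nontrivial E] (μ : Measure E) [μ.IsAddHaarMeasure]
    {a : ℝ} (ha : 0 < a + Module.finrank ℝ E) :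
    LocallyIntegrable (fun x : E => ‖x‖ ^ a) μ := by
  rw [locallyIntegrable_iff]
  intro K hK
  obtain ⟨R, hR⟩ := hK.isBounded.subset_ball_lt 0 0
  refine IntegrableOn.mono_set ?_ hR.2
  rw [integrableOn_fun_norm_addHaar μ (f := fun r => r ^ a)]
  have h1 : 1 ≤ Module.finrank ℝ E := Module.finrank_pos
  have h2 : IntegrableOn (fun y : ℝ => y ^ (((Module.finrank ℝ E - 1 : ℕ) : ℝ) + a))
      (Set.Ioo 0 R) := by
    refine ((intervalIntegrable_iff_integrableOn_Ioo_of_le hR.1.le).1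
      (intervalIntegral.intervalIntegrable_rpow' ?_))
    push_cast [h1]; linarith
  refine h2.congr_fun (fun y hy => ?_) measurableSet_Ioo
  simp only [smul_eq_mul]
  rw [Real.rpow_add hy.1, Real.rpow_natCast]

theorem riesz_posSemidef [Nontrivial E] (μ : Measure E) [μ.IsAddHaarMeasure] {a c : ℝ}
    (ha : 0 < a + Module.finrank ℝ E) (ha0 : a < 0) (hc : 0 ≤ c) :
    (Matrix.of fun A B : BddBorel E =>
      ∫ x in A.1, ∫ y in B.1, c * ‖x - y‖ ^ a ∂μ ∂μ).PosSemidef := by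
  have hne : ∀ᵐ x ∂μ, x ≠ (0 : E) := by simp [ae_iff]
  have hG : 0 < Real.Gamma (-a / 2) := Real.Gamma_pos_of_pos (by linarith)
  have hval : ∀ x : E, x ≠ 0 → ∫ w in Set.Ioi (0 : ℝ),
      c / Real.Gamma (-a / 2) * w ^ (-a / 2 - 1) * Real.exp (-w * ‖x‖ ^ 2) = c * ‖x‖ ^ a := by
    intro x hx
    have hx' : 0 < ‖x‖ := norm_pos_iff.2 hx
    have h := Real.integral_rpow_mul_exp_neg_mul_Ioi (a := -a / 2) (r := ‖x‖ ^ 2)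
      (by linarith) (by positivity)
    have e : ∀ w : ℝ, c / Real.Gamma (-a / 2) * w ^ (-a / 2 - 1) * Real.exp (-w * ‖x‖ ^ 2) =
        c / Real.Gamma (-a / 2) * (w ^ (-a / 2 - 1) * Real.exp (-(‖x‖ ^ 2 * w))) := by
      intro w; rw [show -w * ‖x‖ ^ 2 = -(‖x‖ ^ 2 * w) by ring]; ring
    simp only [e]
    rw [integral_const_mul, h, one_div, ← Real.rpow_natCast ‖x‖ 2, ← Real.rpow_neg hx'.le,
      ← Real.rpow_mul hx'.le]
    rw [show -((2 : ℕ) : ℝ) * (-a / 2) = a by push_cast; ring]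
    rw [mul_comm (‖x‖ ^ a), ← mul_assoc, div_mul_cancel₀ _ hG.ne']
  refine mixture_posSemidef μ (f := fun x => c * ‖x‖ ^ a)
    ((locallyIntegrable_norm_rpow μ ha).smul c)
    (fun w => w) (fun w => c / Real.Gamma (-a / 2) * w ^ (-a / 2 - 1))
    (by fun_prop) (by fun_prop) (fun w hw => le_of_lt hw)
    (fun w hw => mul_nonneg (by positivity) (Real.rpow_nonneg (le_of_lt hw) _)) ?_ ?_
  · filter_upwards [hne] with x hx
    have hx' : 0 < ‖x‖ := norm_pos_iff.2 hx
    rcases hc.eq_or_lt with rfl | hc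
    · simp
    · refine Integrable.of_integral_ne_zero ?_
      rw [hval x hx]; positivity
  · filter_upwards [hne] with x hx using (hval x hx).symm

/-- The Gaussian mixture defining the Bessel kernel, without normalizing constant. -/
noncomputable def besselMixture (n α : ℝ) (x : E) : ℝ :=
  ∫ w in Set.Ioi (0 : ℝ), w ^ ((α - n) / 2 - 1) * Real.exp (-w) * Real.exp (-‖x‖ ^ 2 / (4 * w))

theorem integrable_bessel_prod {α : ℝ} (hα : 0 < α) :
    Integrable (fun p : E × ℝ => p.2 ^ ((α - Module.finrank ℝ E) / 2 - 1) * Real.exp (-p.2) *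
      Real.exp (-‖p.1‖ ^ 2 / (4 * p.2)))
      ((volume : Measure E).prod (volume.restrict (Set.Ioi 0))) := by
  set n : ℝ := (Module.finrank ℝ E : ℝ)
  have hg : ∀ w ∈ Set.Ioi (0 : ℝ), ∫ v : E, Real.exp (-‖v‖ ^ 2 / (4 * w)) =
      (4 * Real.pi) ^ (n / 2) * w ^ (n / 2) := by
    intro w hw
    have hw : 0 < w := hw
    have h := GaussianFourier.integral_rexp_neg_mul_sq_norm (V := E) (b := 1 / (4 * w))
      (by positivity)
    rw [← Real.mul_rpow (by positivity) hw.le]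
    convert h using 2
    · ext v; congr 1; ring
    · field_simp
  rw [integrable_prod_iff' (by fun_prop)]
  constructor
  · filter_upwards [ae_restrict_mem measurableSet_Ioi] with w hw
    refine Integrable.const_mul (Integrable.of_integral_ne_zero ?_) _
    rw [hg w hw]
    have hw : 0 < w := hw
    positivity
  · have h1 := (Real.GammaIntegral_convergent (s := α / 2) (by linarith)).const_mul
      ((4 * Real.pi) ^ (n / 2))
    refine h1.congr ?_
    filter_upwards [ae_restrict_mem measurableSet_Ioi] with w hw
    have hw' : 0 < w := hw
    have e : ∀ v : E, ‖w ^ ((α - n) / 2 - 1) * Real.exp (-w) * Real.exp (-‖v‖ ^ 2 / (4 * w))‖ =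
        w ^ ((α - n) / 2 - 1) * Real.exp (-w) * Real.exp (-‖v‖ ^ 2 / (4 * w)) := fun v =>
      Real.norm_of_nonneg (by positivity)
    simp only [e]
    rw [integral_const_mul, hg w hw, show α / 2 - 1 = ((α - n) / 2 - 1) + n / 2 by ring,
      Real.rpow_add hw']
    ring

theorem locallyIntegrable_bessel {α : ℝ} (hα : 0 < α) (c : ℝ) :
    LocallyIntegrable (fun x : E => c * besselMixture (Module.finrank ℝ E) α x) volume :=
  ((integrable_bessel_prod (E := E) hα).integral_prod_left.const_mul c).locallyIntegrable

theorem bessel_posSemidef {α c : ℝ} (hα : 0 < α) (hc : 0 ≤ c) :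
    (Matrix.of fun A B : BddBorel E =>
      ∫ x in A.1, ∫ y in B.1, c * besselMixture (Module.finrank ℝ E) α (x - y)).PosSemidef := by
  have h := (integrable_bessel_prod (E := E) hα).prod_right_ae
  have e : ∀ (x : E) (w : ℝ),
      c * (w ^ ((α - Module.finrank ℝ E) / 2 - 1) * Real.exp (-w)) *
        Real.exp (-(1 / (4 * w)) * ‖x‖ ^ 2) =
      c * (w ^ ((α - Module.finrank ℝ E) / 2 - 1) * Real.exp (-w) *
        Real.exp (-‖x‖ ^ 2 / (4 * w))) := by
    intro x w
    rw [show -(1 / (4 * w)) * ‖x‖ ^ 2 = -‖x‖ ^ 2 / (4 * w) by ring]; ring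
  refine mixture_posSemidef volume
    (f := fun x => c * besselMixture (Module.finrank ℝ E) α x)
    (locallyIntegrable_bessel hα c) (fun w => 1 / (4 * w))
    (fun w => c * (w ^ ((α - Module.finrank ℝ E) / 2 - 1) * Real.exp (-w)))
    (by fun_prop) (by fun_prop) (fun w hw => ?_) (fun w hw => ?_) ?_ ?_
  · have hw : 0 < w := hw
    positivity
  · have hw : 0 < w := hw
    positivity
  · filter_upwards [h] with x hx
    simp only [e]
    exact hx.const_mul c
  · refine Filter.Eventually.of_forall fun x => ?_
    simp only [e]
    rw [integral_const_mul]
    rfl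

end Kernels

/-! ### Spatial covariance kernels -/

/-- The space `ℝ^d` with its Euclidean norm. -/
abbrev Space (d : ℕ) : Type := EuclideanSpace ℝ (Fin d)

/-- A spatial covariance kernel: a locally integrable function `f` on `ℝ^d` for which
`(A, B) ↦ ∫_A ∫_B f (x - y) dy dx` is symmetric and nonnegative definite on bounded Borel sets. -/
structure CovKernel (d : ℕ) where
  /-- the underlying function -/
  toFun : Space d → ℝ
  locallyIntegrable : LocallyIntegrable toFun
  posSemidef : (Matrix.of fun A B : BddBorel (Space d) =>
    ∫ x in A.1, ∫ y in B.1, toFun (x - y)).PosSemidef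

/-- The Riesz kernel of order `α`, for `0 < α < d`:
`f x = Γ((d - α)/2) 2^{-α} π^{-d/2} / Γ(α/2) * |x|^{-d + α}`. -/
noncomputable def rieszKernel (d : ℕ) (α : ℝ) (hα : 0 < α) (hd : α < d) : CovKernel d where
  toFun x := Real.Gamma ((d - α) / 2) * 2 ^ (-α) * Real.pi ^ (-(d : ℝ) / 2) / Real.Gamma (α / 2) *
    ‖x‖ ^ (-(d : ℝ) + α)
  locallyIntegrable := by
    have hd0 : 0 < d := by exact_mod_cast hα.trans hd
    have : NeZero d := ⟨hd0.ne'⟩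
    refine (locallyIntegrable_norm_rpow (volume : Measure (Space d)) (a := -(d : ℝ) + α) ?_).smul
      (Real.Gamma ((d - α) / 2) * 2 ^ (-α) * Real.pi ^ (-(d : ℝ) / 2) / Real.Gamma (α / 2))
    simpa using hα
  posSemidef := by
    have hd0 : 0 < d := by exact_mod_cast hα.trans hd
    have : NeZero d := ⟨hd0.ne'⟩
    have h1 : 0 < Real.Gamma ((d - α) / 2) := Real.Gamma_pos_of_pos (by linarith)
    have h2 : 0 < Real.Gamma (α / 2) := Real.Gamma_pos_of_pos (by linarith)
    exact riesz_posSemidef (volume : Measure (Space d)) (by simpa using hα) (by linarith)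
      (by positivity)

/-- The Bessel kernel of order `α > 0`:
`f x = ((4π)^{d/2} Γ(α/2))⁻¹ ∫_0^∞ w^{(α-d)/2-1} e^{-w} e^{-|x|²/(4w)} dw`. -/
noncomputable def besselKernel (d : ℕ) (α : ℝ) (hα : 0 < α) : CovKernel d where
  toFun x := ((4 * Real.pi) ^ ((d : ℝ) / 2) * Real.Gamma (α / 2))⁻¹ *
    ∫ w in Set.Ioi (0 : ℝ),
      w ^ ((α - d) / 2 - 1) * Real.exp (-w) * Real.exp (-‖x‖ ^ 2 / (4 * w))
  locallyIntegrable := by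
    have h := locallyIntegrable_bessel (E := Space d) hα
      ((4 * Real.pi) ^ ((d : ℝ) / 2) * Real.Gamma (α / 2))⁻¹
    rw [finrank_euclideanSpace_fin] at h
    exact h
  posSemidef := by
    have h2 : 0 < Real.Gamma (α / 2) := Real.Gamma_pos_of_pos (by linarith)
    have h := bessel_posSemidef (E := Space d) hα
      (c := ((4 * Real.pi) ^ ((d : ℝ) / 2) * Real.Gamma (α / 2))⁻¹) (by positivity)
    rw [finrank_euclideanSpace_fin] at h
    exact h

/-! ### The Hilbert space of the noise -/

/-- The index set of the indicators `1_{[0,t] × A}`: `t ≥ 0` and `A` a bounded Borel set. -/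
abbrev RectIndex (d : ℕ) : Type := ℝ≥0 × BddBorel (Space d)

/-- The Hurst index of the noise, restricted to `[1/2, 1)`. -/
abbrev Hurst : Type := Set.Ico (1 / 2 : ℝ) 1

/-- The inner product `⟨1_{[0,t] × A}, 1_{[0,s] × B}⟩`. -/
noncomputable def rectCov {d : ℕ} (H : Hurst) (f : CovKernel d) (i j : RectIndex d) : ℝ :=
  if H.1 = 1 / 2 then
    min (i.1 : ℝ) (j.1 : ℝ) * ∫ x in i.2.1, ∫ y in j.2.1, f.toFun (x - y)
  else
    H.1 * (2 * H.1 - 1) * ∫ u in (0 : ℝ)..i.1, ∫ v in (0 : ℝ)..j.1,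
      ∫ x in i.2.1, ∫ y in j.2.1, |u - v| ^ (2 * H.1 - 2) * f.toFun (x - y)

theorem timeCov_posSemidef (H : Hurst) :
    (Matrix.of fun t s : ℝ≥0 => if H.1 = 1 / 2 then min (t : ℝ) (s : ℝ) else
      H.1 * (2 * H.1 - 1) * ∫ u in (0 : ℝ)..t, ∫ v in (0 : ℝ)..s,
        |u - v| ^ (2 * H.1 - 2)).PosSemidef := by
  obtain ⟨h1, h2⟩ := H.2
  split_ifs with hH
  · have h := posSemidef_of_integral (volume : Measure ℝ)
      (fun w => Matrix.of fun t s : ℝ≥0 => (Set.Ioc (0 : ℝ) t).indicator (fun _ => (1 : ℝ)) w *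
        (Set.Ioc (0 : ℝ) s).indicator (fun _ => (1 : ℝ)) w)
      (Filter.Eventually.of_forall fun w => posSemidef_mul_self _)
    have e : ∀ t s : ℝ≥0, (fun w => (Set.Ioc (0 : ℝ) t).indicator (fun _ => (1 : ℝ)) w *
        (Set.Ioc (0 : ℝ) s).indicator (fun _ => (1 : ℝ)) w) =
        (Set.Ioc (0 : ℝ) (min (t : ℝ) s)).indicator (fun _ => (1 : ℝ)) := by
      intro t s
      ext w
      simp only [← Set.inter_indicator_mul, mul_one, Set.Ioc_inter_Ioc, max_self]
    simp only [Matrix.of_apply, e] at h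
    have h' := h fun t s =>
      (integrable_indicator_iff measurableSet_Ioc).2 (integrableOn_const (by simp))
    convert h' using 1
    ext t s
    simp only [Matrix.of_apply]
    rw [integral_indicator measurableSet_Ioc]
    simp
  · have hH' : 1 / 2 < H.1 := lt_of_le_of_ne h1 (Ne.symm hH)
    have h := (riesz_posSemidef (volume : Measure ℝ) (a := 2 * H.1 - 2)
      (c := H.1 * (2 * H.1 - 1)) (by simp; linarith) (by linarith)
      (mul_nonneg (by linarith) (by linarith))).submatrix
      (fun t : ℝ≥0 => (⟨Set.Ioc 0 (t : ℝ), measurableSet_Ioc, Metric.isBounded_Ioc _ _⟩ :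
        BddBorel ℝ))
    convert h using 1
    ext t s
    simp only [Matrix.submatrix_apply, Matrix.of_apply, Real.norm_eq_abs]
    simp only [integral_const_mul, intervalIntegral.integral_of_le (NNReal.coe_nonneg _)]

/-- The factorization of the inner product into a temporal and a spatial covariance. -/
theorem rectCov_eq_mul {d : ℕ} (H : Hurst) (f : CovKernel d) (i j : RectIndex d) :
    rectCov H f i j = (if H.1 = 1 / 2 then min (i.1 : ℝ) (j.1 : ℝ) else
      H.1 * (2 * H.1 - 1) * ∫ u in (0 : ℝ)..i.1, ∫ v in (0 : ℝ)..j.1,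
        |u - v| ^ (2 * H.1 - 2)) * ∫ x in i.2.1, ∫ y in j.2.1, f.toFun (x - y) := by
  rw [rectCov]
  split_ifs
  · rfl
  · simp only [integral_const_mul, intervalIntegral.integral_mul_const]
    ring

theorem rectCov_posSemidef {d : ℕ} (H : Hurst) (f : CovKernel d) :
    (Matrix.of (rectCov H f)).PosSemidef := by
  have h := ((timeCov_posSemidef H).submatrix (Prod.fst : RectIndex d → ℝ≥0)).hadamard
    (f.posSemidef.submatrix (Prod.snd : RectIndex d → BddBorel (Space d)))
  have e : Matrix.of (rectCov H f) = _ := Matrix.ext fun i j => rectCov_eq_mul H f i j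
  rw [e]
  exact h

/-- Finite linear combinations of the indicators `1_{[0,t] × A}`. -/
def PreHP {d : ℕ} (_H : Hurst) (_f : CovKernel d) : Type := RectIndex d →₀ ℝ

noncomputable instance {d : ℕ} (H : Hurst) (f : CovKernel d) : AddCommGroup (PreHP H f) :=
  inferInstanceAs (AddCommGroup (RectIndex d →₀ ℝ))

noncomputable instance {d : ℕ} (H : Hurst) (f : CovKernel d) : Module ℝ (PreHP H f) :=
  inferInstanceAs (Module ℝ (RectIndex d →₀ ℝ))

/-- The bilinear extension of `rectCov` to linear combinations of indicators. -/
@[reducible] noncomputable def PreHP.core {d : ℕ} (H : Hurst) (f : CovKernel d) :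
    PreInnerProductSpace.Core ℝ (PreHP H f) where
  inner φ ψ := Finsupp.sum (M := ℝ) φ fun i a => Finsupp.sum (M := ℝ) ψ fun j b =>
    a * rectCov H f i j * b
  conj_inner_symm φ ψ := by
    simp only [conj_trivial, Finsupp.sum]
    rw [Finset.sum_comm]
    refine Finset.sum_congr rfl fun i _ => Finset.sum_congr rfl fun j _ => ?_
    have h : rectCov H f j i = rectCov H f i j := by
      simpa using (rectCov_posSemidef H f).1.apply i j
    rw [h]; ring
  re_inner_nonneg φ := by
    simpa using (rectCov_posSemidef H f).2 φ
  add_left φ ψ χ := by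
    refine Finsupp.sum_add_index' (f := φ) (g := ψ) (fun i => ?_) (fun i a b => ?_)
    · simp [Finsupp.sum]
    · simp only [Finsupp.sum, add_mul, Finset.sum_add_distrib]
  smul_left φ ψ r := by
    refine (Finsupp.sum_smul_index' (g := φ) (b := r) (fun i => ?_)).trans ?_
    · simp [Finsupp.sum]
    · simp only [Finsupp.sum, smul_eq_mul, Finset.mul_sum, conj_trivial, mul_assoc]

noncomputable instance {d : ℕ} (H : Hurst) (f : CovKernel d) :
    SeminormedAddCommGroup (PreHP H f) :=
  @InnerProductSpace.Core.toSeminormedAddCommGroup ℝ _ _ _ _ (PreHP.core H f)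

noncomputable instance {d : ℕ} (H : Hurst) (f : CovKernel d) :
    InnerProductSpace ℝ (PreHP H f) :=
  InnerProductSpace.ofCore (PreHP.core H f)

/-- The Hilbert space of the noise: the completion of the linear combinations of the indicators
`1_{[0,t] × A}` with respect to the inner product determined by `rectCov` (elements at distance
zero are identified). -/
abbrev HP {d : ℕ} (H : Hurst) (f : CovKernel d) : Type := UniformSpace.Completion (PreHP H f)

/-- The indicator `1_{[0,t] × A}`, as a linear combination with one term. -/
noncomputable def PreHP.rect {d : ℕ} (H : Hurst) (f : CovKernel d) (i : RectIndex d) :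
    PreHP H f :=
  Finsupp.single (M := ℝ) i 1

/-- The indicator `1_{[0,t] × A}`, as an element of the Hilbert space. -/
noncomputable def rect {d : ℕ} (H : Hurst) (f : CovKernel d) (t : ℝ≥0)
    (A : BddBorel (Space d)) : HP H f :=
  (PreHP.rect H f (t, A) : UniformSpace.Completion (PreHP H f))

theorem inner_rect {d : ℕ} (H : Hurst) (f : CovKernel d) (t s : ℝ≥0)
    (A B : BddBorel (Space d)) :
    ⟪rect H f t A, rect H f s B⟫_ℝ = rectCov H f (t, A) (s, B) := by
  rw [rect, rect, UniformSpace.Completion.inner_coe]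
  change (Finsupp.sum (M := ℝ) (Finsupp.single (t, A) (1 : ℝ)) fun i a =>
    Finsupp.sum (M := ℝ) (Finsupp.single (s, B) (1 : ℝ)) fun j b => a * rectCov H f i j * b) = _
  simp

/-! ### Functions as elements of the Hilbert space -/

/-- The kernel operator of the inner product applied to `1_{[0,s] × B}`, so that (formally)
`⟨φ, 1_{[0,s] × B}⟩ = ∫_{ℝ₊ × ℝ^d} φ(r, y) rectPotential s B (r, y) dr dy`. -/
noncomputable def rectPotential {d : ℕ} (H : Hurst) (f : CovKernel d) (s : ℝ≥0)
    (B : BddBorel (Space d)) (p : ℝ × Space d) : ℝ :=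
  if H.1 = 1 / 2 then
    (Set.Icc (0 : ℝ) s).indicator (fun _ => (1 : ℝ)) p.1 * ∫ z in B.1, f.toFun (p.2 - z)
  else
    H.1 * (2 * H.1 - 1) * ∫ v in (0 : ℝ)..s, ∫ z in B.1,
      |p.1 - v| ^ (2 * H.1 - 2) * f.toFun (p.2 - z)

/-- The function `φ` on `ℝ₊ × ℝ^d` belongs to the Hilbert space and is, as an element of that
space, equal to `h`: its inner products with all indicators `1_{[0,s] × B}` (given by absolutely
convergent integrals) are those of `h`. As the indicators are total, `φ` determines `h`. -/
def IsElement {d : ℕ} {H : Hurst} {f : CovKernel d} (φ : ℝ × Space d → ℝ) (h : HP H f) : Prop :=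
  ∀ (s : ℝ≥0) (B : BddBorel (Space d)),
    IntegrableOn (fun p => φ p * rectPotential H f s B p) (Set.Ici 0 ×ˢ Set.univ) ∧
      ⟪h, rect H f s B⟫_ℝ = ∫ p in Set.Ici 0 ×ˢ Set.univ, φ p * rectPotential H f s B p

/-! ### The noise, the Malliavin derivative and the Skorohod integral -/

section Noise

variable {d : ℕ} {H : Hurst} {f : CovKernel d} {Ω : Type*} [mΩ : MeasurableSpace Ω]

/-- `W` is a zero-mean Gaussian process indexed by the Hilbert space, with covariance
`E (W h * W g) = ⟨h, g⟩`. -/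
structure IsNoise (W : HP H f → Ω → ℝ) (P : Measure Ω) : Prop where
  measurable : ∀ h, Measurable (W h)
  isGaussianProcess : IsGaussianProcess W P
  mean : ∀ h, ∫ ω, W h ω ∂P = 0
  cov : ∀ h g, ∫ ω, W h ω * W g ω ∂P = ⟪h, g⟫_ℝ

/-- The `σ`-field generated by `W 1_{[0,s] × A}`, `s ∈ [0,t]`, `A` bounded Borel. -/
@[reducible] noncomputable def noiseFiltration (W : HP H f → Ω → ℝ) (t : ℝ) : MeasurableSpace Ω :=
  ⨆ (s : ℝ≥0) (_ : (s : ℝ) ≤ t) (A : BddBorel (Space d)),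
    MeasurableSpace.comap (W (rect H f s A)) inferInstance

/-- `φ ∈ C_b^∞(ℝⁿ)`: smooth, and bounded together with all its derivatives. -/
def IsSmoothBounded {n : ℕ} (φ : (Fin n → ℝ) → ℝ) : Prop :=
  ContDiff ℝ (⊤ : ℕ∞) φ ∧ ∀ k : ℕ, ∃ C : ℝ, ∀ x, ‖iteratedFDeriv ℝ k φ x‖ ≤ C

/-- The pairs `(F, DF)` with `F = φ(W(h₁), …, W(hₙ))` a smooth cylindrical random variable and
`DF = ∑ᵢ ∂ᵢφ(W(h₁), …, W(hₙ)) hᵢ`. -/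
def smoothDerivGraph (W : HP H f → Ω → ℝ) (P : Measure Ω) :
    Set (Lp ℝ 2 P × Lp (HP H f) 2 P) :=
  {q | ∃ (n : ℕ) (φ : (Fin n → ℝ) → ℝ) (h : Fin n → HP H f), IsSmoothBounded φ ∧
    (q.1 =ᵐ[P] fun ω => φ fun i => W (h i) ω) ∧
    (q.2 =ᵐ[P] fun ω => ∑ i, fderiv ℝ φ (fun j => W (h j) ω) (Pi.single i 1) • h i)}

/-- The pairs `(F, DF)` with `F ∈ 𝔻^{1,2}`: the completion of the smooth cylindrical random
variables in the norm `‖F‖² = E |F|² + E ‖DF‖²`, i.e. the closure of the graph of `D` in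
`L²(Ω) × L²(Ω; HP)`. -/
def malliavinGraph (W : HP H f → Ω → ℝ) (P : Measure Ω) :
    Set (Lp ℝ 2 P × Lp (HP H f) 2 P) :=
  closure (smoothDerivGraph W P)

/-- `Z ∈ L²(Ω; HP)` is in the domain of the Skorohod integral `δ`, the adjoint of `D`, and
`δ(Z) = G`: for all `F ∈ 𝔻^{1,2}`, `E (F G) = E ⟨DF, Z⟩`. -/
structure IsSkorohodIntegral (W : HP H f → Ω → ℝ) (P : Measure Ω) (Z : Ω → HP H f)
    (G : Ω → ℝ) : Prop where
  memLp_integrand : MemLp Z 2 P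
  memLp_integral : MemLp G 2 P
  duality : ∀ q ∈ malliavinGraph W P, ∫ ω, q.1 ω * G ω ∂P = ∫ ω, ⟪q.2 ω, Z ω⟫_ℝ ∂P

/-- The random field `Y` on `ℝ₊ × ℝ^d` is, as a random element of the Hilbert space, equal to `Z`:
for every event `S`, the function `(r, y) ↦ E (Y_{r,y}; S)` is the element `E (Z; S)`. -/
def IsRandomElement (P : Measure Ω) (Y : ℝ × Space d → Ω → ℝ) (Z : Ω → HP H f) : Prop :=
  ∀ S : Set Ω, MeasurableSet S → IsElement (fun p => ∫ ω in S, Y p ω ∂P) (∫ ω in S, Z ω ∂P)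

/-- The random field `Y` is integrable with respect to the noise `W`, with stochastic integral
`G = ∫ Y δW`. -/
def HasStochIntegral (W : HP H f → Ω → ℝ) (P : Measure Ω) (Y : ℝ × Space d → Ω → ℝ)
    (G : Ω → ℝ) : Prop :=
  ∃ Z : Ω → HP H f, IsRandomElement P Y Z ∧ IsSkorohodIntegral W P Z G

end Noise

/-! ### The stochastic heat equation -/

/-- The heat kernel `p_t(x) = (2πt)^{-d/2} exp(-|x|²/(2t))`, for `t > 0`. -/
noncomputable def heatKernel {d : ℕ} (t : ℝ) (x : Space d) : ℝ :=
  (2 * Real.pi * t) ^ (-(d : ℝ) / 2) * Real.exp (-‖x‖ ^ 2 / (2 * t))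

/-- `p_t φ (x) = ∫ p_t(x - y) φ(y) dy` for `t > 0`, and `p_0 φ = φ`. -/
noncomputable def heatSemigroup {d : ℕ} (t : ℝ) (φ : Space d → ℝ) (x : Space d) : ℝ :=
  if t = 0 then φ x else ∫ y, heatKernel t (x - y) * φ y

/-- `u = (u_{t,x})`, `t ≥ 0`, `x ∈ ℝ^d`, is a (mild, Skorohod) solution on `ℝ₊ × ℝ^d` of
`∂u/∂t = ½ Δu + u Ẇ`, `u_{0,x} = u₀(x)`: an adapted square-integrable process such that for all
`(t, x)` the field `Y^{t,x}_{s,y} = 1_{[0,t]}(s) p_{t-s}(x - y) u_{s,y}` is integrable with respect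
to `W` and `u_{t,x} = p_t u₀(x) + ∫ Y^{t,x} δW` almost surely. -/
structure IsHeatSolution {d : ℕ} {H : Hurst} {f : CovKernel d} {Ω : Type*} [MeasurableSpace Ω]
    (W : HP H f → Ω → ℝ) (P : Measure Ω) (u₀ : Space d → ℝ) (u : ℝ → Space d → Ω → ℝ) : Prop where
  memLp : ∀ t, 0 ≤ t → ∀ x, MemLp (u t x) 2 P
  adapted : ∀ t, 0 ≤ t → ∀ x, AEStronglyMeasurable[noiseFiltration W t] (u t x) P
  mild : ∀ t, 0 ≤ t → ∀ x, ∃ G : Ω → ℝ,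
    HasStochIntegral W P
      (fun p ω => (Set.Icc 0 t).indicator (fun s => heatKernel (t - s) (x - p.2) * u s p.2 ω) p.1)
      G ∧
    ∀ᵐ ω ∂P, u t x ω = heatSemigroup t u₀ x + G ω

end FracHeat

open FracHeat

/-! A Skorohod integral has mean zero (duality against F = 1, DF = 0), so every solution has E
u_{s,y} = 1. Taking expectations in the integrand of the mild equation at t = 1, x = 0 then shows
that the deterministic function 1_{[0,1]}(s) p_{1-s}(y) represents an element h of the Hilbert
space. The theorem is the statement that this forces 4H + α - d > 0.

Near (1, 0) the heat kernel is cut into parabolic pieces. At scale r = 2^{-(k+1)}, for 1 - s between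
r² and 2r² and |y| ≤ r, it is at least κ r^{-d}, with κ independent of k. Put e_k = r^{-d} 1_{region
k}. The regions are disjoint, so κ ∑ e_k lies below the heat kernel pointwise. The kernel f is
bounded below by a multiple of ρ^{α-d} on |x| ≤ ρ, and the temporal kernel scales with exponent 2H -
2, so ‖e_k‖² is at least a constant times r^{4H+α-d} (`le_inner_scaled_slab`). If 4H + α - d ≤ 0
this stays above some δ > 0 at every scale; the borderline case is included because infinitely many
scales contribute.

The completion is not a space of functions, so a pointwise inequality does not compare norms
directly. It does compare inner products with each e_l, which are integrals against a nonnegative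
potential (`IsElement.inner_slab_le`). With Ψ = ∑_{k<N} e_k, summing κ⟨Ψ, e_l⟩ ≤ ⟨h, e_l⟩ over l < N
gives κ‖Ψ‖² ≤ ⟨h, Ψ⟩, hence ‖Ψ‖ ≤ ‖h‖/κ by Cauchy-Schwarz. But the cross terms are nonnegative, so
‖Ψ‖² ≥ Nδ, which is absurd for large N (`exists_inner_sum_gt`). -/

namespace FracHeat

/-! ### Potentials of rectangles and slabs -/

section Potential

variable {d : ℕ} {H : Hurst} {f : CovKernel d}

/-- The temporal factor of `rectPotential`. -/
noncomputable def timePotential (H : Hurst) (s : ℝ≥0) (r : ℝ) : ℝ :=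
  if H.1 = 1 / 2 then (Set.Icc (0 : ℝ) s).indicator (fun _ => (1 : ℝ)) r
  else H.1 * (2 * H.1 - 1) * ∫ v in (0 : ℝ)..s, |r - v| ^ (2 * H.1 - 2)

/-- The spatial factor of `rectPotential`. -/
noncomputable def spacePotential (f : CovKernel d) (B : BddBorel (Space d)) (y : Space d) : ℝ :=
  ∫ z in B.1, f.toFun (y - z)

theorem rectPotential_eq_mul (s : ℝ≥0) (B : BddBorel (Space d)) (p : ℝ × Space d) :
    rectPotential H f s B p = timePotential H s p.1 * spacePotential f B p.2 := by
  rw [rectPotential, timePotential, spacePotential]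
  split_ifs
  · rfl
  · simp only [integral_const_mul, intervalIntegral.integral_mul_const]
    ring

theorem one_half_lt_of_ne (hH : H.1 ≠ 1 / 2) : 1 / 2 < H.1 := lt_of_le_of_ne H.2.1 (Ne.symm hH)

theorem locallyIntegrable_abs_rpow (hH : H.1 ≠ 1 / 2) :
    LocallyIntegrable (fun r : ℝ => |r| ^ (2 * H.1 - 2)) volume := by
  have h := locallyIntegrable_norm_rpow (volume : Measure ℝ) (a := 2 * H.1 - 2)
    (by simp; linarith [one_half_lt_of_ne hH])
  simpa only [Real.norm_eq_abs] using h

theorem intervalIntegrable_abs_sub_rpow (hH : H.1 ≠ 1 / 2) (r a b : ℝ) :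
    IntervalIntegrable (fun v => |r - v| ^ (2 * H.1 - 2)) volume a b := by
  have h : IntervalIntegrable (fun v : ℝ => |v| ^ (2 * H.1 - 2)) volume (r - a) (r - b) :=
    ((locallyIntegrable_abs_rpow hH).integrableOn_isCompact isCompact_uIcc).intervalIntegrable
  simpa using h.comp_sub_left r

theorem integrableOn_timePotential (t s : ℝ≥0) :
    IntegrableOn (timePotential H s) (Set.Icc (0 : ℝ) t) := by
  by_cases hH : H.1 = 1 / 2
  · have e : timePotential H s = (Set.Icc (0 : ℝ) s).indicator (fun _ => (1 : ℝ)) := by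
      ext r; simp only [timePotential, if_pos hH]
    rw [e]
    exact (integrableOn_const (by simp)).indicator measurableSet_Icc
  · have h := (integrable_sub_prod volume (locallyIntegrable_abs_rpow hH)
      ⟨Set.Icc (0 : ℝ) t, measurableSet_Icc, Metric.isBounded_Icc _ _⟩
      ⟨Set.Ioc (0 : ℝ) s, measurableSet_Ioc, Metric.isBounded_Ioc _ _⟩).integral_prod_left
    refine (h.const_mul (H.1 * (2 * H.1 - 1))).congr (Filter.Eventually.of_forall fun r => ?_)
    simp only [timePotential, if_neg hH, intervalIntegral.integral_of_le s.coe_nonneg]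

theorem integrableOn_spacePotential (A B : BddBorel (Space d)) :
    IntegrableOn (spacePotential f B) A.1 :=
  (integrable_sub_prod volume f.locallyIntegrable A B).integral_prod_left

theorem rectCov_eq_integral_mul (t s : ℝ≥0) (A B : BddBorel (Space d)) :
    rectCov H f (t, A) (s, B) =
      (∫ r in Set.Icc (0 : ℝ) t, timePotential H s r) * ∫ y in A.1, spacePotential f B y := by
  rw [rectCov_eq_mul]
  congr 1
  by_cases hH : H.1 = 1 / 2
  · simp only [timePotential, if_pos hH]
    rw [setIntegral_indicator measurableSet_Icc, Set.Icc_inter_Icc]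
    simp
  · simp only [timePotential, if_neg hH]
    rw [integral_const_mul, integral_Icc_eq_integral_Ioc, intervalIntegral.integral_of_le t.coe_nonneg]

theorem indicator_one_mul_eq (S : Set (ℝ × Space d)) (g : ℝ × Space d → ℝ) :
    (fun p => S.indicator (fun _ => (1 : ℝ)) p * g p) = S.indicator g := by
  ext p; by_cases hp : p ∈ S <;> simp [hp]

/-- Bridge between the abstract completion and genuine functions: both the covariance and the
potential factor into time and space, so the pairing is a product of two one-factor integrals. -/
theorem isElement_rect (t : ℝ≥0) (A : BddBorel (Space d)) :
    IsElement ((Set.Icc (0 : ℝ) t ×ˢ A.1).indicator fun _ => 1) (rect H f t A) := by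
  intro s B
  have hm : MeasurableSet (Set.Icc (0 : ℝ) t ×ˢ A.1) := measurableSet_Icc.prod A.2.1
  have hsub : Set.Icc (0 : ℝ) t ×ˢ A.1 ⊆ Set.Ici 0 ×ˢ Set.univ :=
    Set.prod_mono Set.Icc_subset_Ici_self (Set.subset_univ _)
  have hr : (volume : Measure (ℝ × Space d)).restrict (Set.Icc (0 : ℝ) t ×ˢ A.1) =
      (volume.restrict (Set.Icc (0 : ℝ) t)).prod (volume.restrict A.1) := by
    rw [Measure.prod_restrict]; rfl
  have he : rectPotential H f s B =
      fun p : ℝ × Space d => timePotential H s p.1 * spacePotential f B p.2 :=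
    funext (rectPotential_eq_mul s B)
  rw [indicator_one_mul_eq]
  constructor
  · refine IntegrableOn.integrable_indicator ?_ hm |>.integrableOn
    rw [IntegrableOn, hr, he]
    exact (integrableOn_timePotential t s).mul_prod (integrableOn_spacePotential A B)
  · rw [setIntegral_indicator hm, Set.inter_eq_self_of_subset_right hsub, hr, he,
      integral_prod_mul, inner_rect, rectCov_eq_integral_mul]

/-! ### Linear calculus of functions representing elements -/

theorem IsElement.add {φ ψ : ℝ × Space d → ℝ} {g h : HP H f} (hφ : IsElement φ g)
    (hψ : IsElement ψ h) : IsElement (fun p => φ p + ψ p) (g + h) := by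
  intro s B
  simp only [add_mul, inner_add_left, (hφ s B).2, (hψ s B).2]
  exact ⟨(hφ s B).1.add (hψ s B).1, (integral_add (hφ s B).1 (hψ s B).1).symm⟩

theorem IsElement.const_smul {φ : ℝ × Space d → ℝ} {h : HP H f} (c : ℝ) (hφ : IsElement φ h) :
    IsElement (fun p => c * φ p) (c • h) := by
  intro s B
  simp only [mul_assoc, real_inner_smul_left, (hφ s B).2, integral_const_mul, and_true]
  exact (hφ s B).1.const_mul c

theorem IsElement.congr {φ ψ : ℝ × Space d → ℝ} {h : HP H f} (hφ : IsElement φ h)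
    (e : ∀ p : ℝ × Space d, 0 ≤ p.1 → φ p = ψ p) : IsElement ψ h := by
  intro s B
  have hm : MeasurableSet (Set.Ici (0 : ℝ) ×ˢ (Set.univ : Set (Space d))) :=
    measurableSet_Ici.prod MeasurableSet.univ
  have e' : Set.EqOn (fun p => φ p * rectPotential H f s B p)
      (fun p => ψ p * rectPotential H f s B p) (Set.Ici 0 ×ˢ Set.univ) := fun p hp => by
    simp only [e p hp.1]
  exact ⟨(hφ s B).1.congr_fun e' hm, (hφ s B).2.trans (setIntegral_congr_fun hm e')⟩

theorem IsElement.zero : IsElement (fun _ => 0) (0 : HP H f) := fun s B => by simp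

theorem IsElement.sum {ι : Type*} (S : Finset ι) {φ : ι → ℝ × Space d → ℝ} {h : ι → HP H f}
    (hφ : ∀ i, IsElement (φ i) (h i)) :
    IsElement (fun p => ∑ i ∈ S, φ i p) (∑ i ∈ S, h i) := by
  classical
  induction S using Finset.induction_on with
  | empty => simpa using IsElement.zero
  | insert i S hi ih => simpa only [Finset.sum_insert hi] using (hφ i).add ih

/-- The indicator `1_{(a,b] × A}`, as an element of the Hilbert space. -/
noncomputable def slab (H : Hurst) (f : CovKernel d) (a b : ℝ≥0) (A : BddBorel (Space d)) :
    HP H f := rect H f b A - rect H f a A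

theorem isElement_slab {a b : ℝ≥0} (hab : a ≤ b) (A : BddBorel (Space d)) :
    IsElement ((Set.Ioc (a : ℝ) b ×ˢ A.1).indicator fun _ => 1) (slab H f a b A) := by
  have h := (isElement_rect (H := H) (f := f) b A).add
    ((isElement_rect (H := H) (f := f) a A).const_smul (-1))
  rw [neg_one_smul, ← sub_eq_add_neg] at h
  refine h.congr fun p hp => ?_
  have hab' : (a : ℝ) ≤ b := hab
  by_cases hA : p.2 ∈ A.1
  · by_cases h1 : p.1 ≤ a
    · simp [Set.indicator, hA, hp, h1, h1.trans hab', not_lt.2 h1]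
    · by_cases h2 : p.1 ≤ b
      · simp [Set.indicator, hA, hp, h1, h2, not_le.1 h1]
      · simp [Set.indicator, hA, hp, h1, h2]
  · simp [Set.indicator, hA]

/-- The kernel operator of the inner product applied to `1_{(a,b] × A}`. -/
noncomputable def slabPotential (H : Hurst) (f : CovKernel d) (a b : ℝ≥0)
    (A : BddBorel (Space d)) (p : ℝ × Space d) : ℝ :=
  rectPotential H f b A p - rectPotential H f a A p

theorem IsElement.inner_slab {φ : ℝ × Space d → ℝ} {h : HP H f} (hφ : IsElement φ h)
    (a b : ℝ≥0) (A : BddBorel (Space d)) :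
    IntegrableOn (fun p => φ p * slabPotential H f a b A p) (Set.Ici 0 ×ˢ Set.univ) ∧
      ⟪h, slab H f a b A⟫_ℝ = ∫ p in Set.Ici 0 ×ˢ Set.univ, φ p * slabPotential H f a b A p := by
  simp only [slabPotential, mul_sub, slab, inner_sub_right, (hφ _ _).2]
  exact ⟨(hφ b A).1.sub (hφ a A).1, (integral_sub (hφ b A).1 (hφ a A).1).symm⟩

theorem slabPotential_eq_mul (a b : ℝ≥0) (A : BddBorel (Space d)) (p : ℝ × Space d) :
    slabPotential H f a b A p =
      (timePotential H b p.1 - timePotential H a p.1) * spacePotential f A p.2 := by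
  simp only [slabPotential, rectPotential_eq_mul, sub_mul]

/-! ### Positivity and lower bounds for slab potentials -/

theorem timePotential_sub_eq (hH : H.1 ≠ 1 / 2) (a b : ℝ≥0) (r : ℝ) :
    timePotential H b r - timePotential H a r =
      H.1 * (2 * H.1 - 1) * ∫ v in (a : ℝ)..b, |r - v| ^ (2 * H.1 - 2) := by
  simp only [timePotential, if_neg hH, ← mul_sub]
  rw [intervalIntegral.integral_interval_sub_left] <;>
  exact intervalIntegrable_abs_sub_rpow hH _ _ _

theorem hurst_const_pos (hH : H.1 ≠ 1 / 2) : 0 < H.1 * (2 * H.1 - 1) := by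
  have := one_half_lt_of_ne hH
  exact mul_pos (by linarith) (by linarith)

theorem timePotential_mono {a b : ℝ≥0} (hab : a ≤ b) (r : ℝ) :
    timePotential H a r ≤ timePotential H b r := by
  have hab' : (a : ℝ) ≤ b := hab
  by_cases hH : H.1 = 1 / 2
  · simp only [timePotential, if_pos hH]
    exact Set.indicator_le_indicator_of_subset (Set.Icc_subset_Icc_right hab')
      (fun _ => zero_le_one) r
  · rw [← sub_nonneg, timePotential_sub_eq hH]
    exact mul_nonneg (hurst_const_pos hH).le
      (intervalIntegral.integral_nonneg hab' fun v _ => Real.rpow_nonneg (abs_nonneg _) _)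

/-- The constant in the lower bound for the variance of temporal increments. -/
noncomputable def incrementConst (H : Hurst) : ℝ :=
  if H.1 = 1 / 2 then 1 else H.1 * (2 * H.1 - 1)

theorem incrementConst_pos (H : Hurst) : 0 < incrementConst H := by
  rw [incrementConst]
  split_ifs with hH
  · exact one_pos
  · exact hurst_const_pos hH

/-- For H > 1/2, |r - v| ≤ b - a and the exponent 2H - 2 is negative, so the integrand is at least
(b - a)^{2H-2} on an interval of length b - a. For H = 1/2 the power is 1, the value of the
indicator of (a, b]. -/
theorem le_timePotential_sub {a b : ℝ≥0} (hab : a < b) {r : ℝ} (hr : r ∈ Set.Ioc (a : ℝ) b) :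
    incrementConst H * ((b : ℝ) - a) ^ (2 * H.1 - 1) ≤
      timePotential H b r - timePotential H a r := by
  have hab' : (a : ℝ) < b := hab
  by_cases hH : H.1 = 1 / 2
  · simp only [timePotential, incrementConst, if_pos hH]
    rw [Set.indicator_of_mem (show r ∈ Set.Icc (0 : ℝ) b from ⟨a.2.trans hr.1.le, hr.2⟩),
      Set.indicator_of_notMem (show r ∉ Set.Icc (0 : ℝ) a from fun h => not_lt.2 h.2 hr.1)]
    simp [hH]
  · rw [timePotential_sub_eq hH, incrementConst, if_neg hH]
    refine mul_le_mul_of_nonneg_left ?_ (hurst_const_pos hH).le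
    have hpos : 0 < (b : ℝ) - a := sub_pos.2 hab'
    have h1 : ∫ _ in (a : ℝ)..b, ((b : ℝ) - a) ^ (2 * H.1 - 2) =
        ((b : ℝ) - a) ^ (2 * H.1 - 1) := by
      rw [intervalIntegral.integral_const, smul_eq_mul,
        show 2 * H.1 - 1 = 1 + (2 * H.1 - 2) by ring, Real.rpow_add hpos, Real.rpow_one]
    rw [← h1, intervalIntegral.integral_of_le hab'.le, intervalIntegral.integral_of_le hab'.le]
    refine integral_mono_ae (integrableOn_const (by simp))
      ((intervalIntegrable_iff_integrableOn_Ioc_of_le hab'.le).1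
        (intervalIntegrable_abs_sub_rpow hH _ _ _)) ?_
    -- At v = r the negative power of 0 has the default value 0 and the bound fails; one point is
    -- negligible.
    have hne : ∀ᵐ v : ℝ, v ≠ r := by simp [ae_iff]
    filter_upwards [ae_restrict_mem measurableSet_Ioc, ae_restrict_of_ae hne] with v hv hvr
    refine Real.rpow_le_rpow_of_nonpos (abs_pos.2 (sub_ne_zero.2 hvr.symm)) ?_
      (by linarith [H.2.2])
    rw [abs_le]
    constructor <;> linarith [hr.1, hr.2, hv.1, hv.2]

theorem slabPotential_nonneg (hf : ∀ x, 0 ≤ f.toFun x) {a b : ℝ≥0} (hab : a ≤ b)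
    (A : BddBorel (Space d)) (p : ℝ × Space d) : 0 ≤ slabPotential H f a b A p := by
  rw [slabPotential_eq_mul]
  exact mul_nonneg (sub_nonneg.2 (timePotential_mono hab _)) (integral_nonneg fun z => hf _)

/-- Pairing with a slab is integration against its potential, which is nonnegative. This is the only
way in which pointwise order of functions enters the Hilbert space. -/
theorem IsElement.inner_slab_le {φ ψ : ℝ × Space d → ℝ} {g h : HP H f} (hf : ∀ x, 0 ≤ f.toFun x)
    (hφ : IsElement φ g) (hψ : IsElement ψ h) (hle : ∀ p : ℝ × Space d, 0 ≤ p.1 → φ p ≤ ψ p)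
    {a b : ℝ≥0} (hab : a ≤ b) (A : BddBorel (Space d)) :
    ⟪g, slab H f a b A⟫_ℝ ≤ ⟪h, slab H f a b A⟫_ℝ := by
  rw [(hφ.inner_slab a b A).2, (hψ.inner_slab a b A).2]
  refine setIntegral_mono_on (hφ.inner_slab a b A).1 (hψ.inner_slab a b A).1
    (measurableSet_Ici.prod MeasurableSet.univ) fun p hp => ?_
  exact mul_le_mul_of_nonneg_right (hle p hp.1) (slabPotential_nonneg hf hab A p)

theorem inner_slab_slab_nonneg (hf : ∀ x, 0 ≤ f.toFun x) {a b a' b' : ℝ≥0} (hab : a ≤ b)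
    (hab' : a' ≤ b') (A A' : BddBorel (Space d)) :
    0 ≤ ⟪slab H f a b A, slab H f a' b' A'⟫_ℝ := by
  have h := IsElement.inner_slab_le hf (IsElement.zero (H := H)) (isElement_slab hab A)
    (fun p _ => Set.indicator_nonneg (fun _ _ => zero_le_one) p) hab' A'
  simpa using h

/-- A kernel bounded below like `|x|^e` near the origin. -/
def HasLowerPower (f : CovKernel d) (e c : ℝ) : Prop :=
  ∀ᵐ x : Space d, ∀ ρ : ℝ, 0 < ρ → ρ ≤ 2 → ‖x‖ ≤ ρ → c * ρ ^ e ≤ f.toFun x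

/-- A closed ball around the origin, as a bounded Borel set. -/
def originBall (d : ℕ) (r : ℝ) : BddBorel (Space d) :=
  ⟨Metric.closedBall 0 r, measurableSet_closedBall, Metric.isBounded_closedBall⟩

theorem le_spacePotential {e c r : ℝ} (hf : HasLowerPower f e c) (hr : 0 < r) (hr1 : r ≤ 1)
    {y : Space d} (hy : y ∈ (originBall d r).1) :
    c * (2 * r) ^ e * volume.real (originBall d r).1 ≤ spacePotential f (originBall d r) y := by
  have hfin : volume (originBall d r).1 ≠ ∞ := measure_closedBall_lt_top.ne
  rw [spacePotential, mul_comm _ (volume.real _), ← smul_eq_mul, ← setIntegral_const]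
  have hi : Integrable (fun z => f.toFun (y - z)) (volume.restrict (originBall d r).1) := by
    -- The kernel is only locally integrable, so it is first cut off to the compact set y - ball and
    -- then reflected and translated.
    have hK : IsCompact ((fun z => y - z) '' (originBall d r).1) :=
      (isCompact_closedBall _ _).image (by fun_prop)
    have h1 := ((f.locallyIntegrable.integrableOn_isCompact hK).integrable_indicator
      hK.measurableSet).comp_sub_left y
    refine h1.integrableOn.congr_fun (fun z hz => ?_) (originBall d r).2.1
    exact Set.indicator_of_mem (Set.mem_image_of_mem (fun z => y - z) hz) _
  refine integral_mono_ae (integrableOn_const hfin) hi ?_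
  have hq := quasiMeasurePreserving_sub_left (volume : Measure (Space d)) y
  filter_upwards [ae_restrict_mem (originBall d r).2.1, ae_restrict_of_ae (hq.ae hf)] with z hz hfz
  -- Two points of the ball are at distance at most 2r, which is at most 2, the range allowed in
  -- `HasLowerPower`.
  refine hfz (2 * r) (by linarith) (by linarith) ((norm_sub_le _ _).trans ?_)
  have h1 : ‖y‖ ≤ r := by simpa [originBall] using hy
  have h2 : ‖z‖ ≤ r := by simpa [originBall] using hz
  linarith

/-- The squared norm is the integral of the slab's own potential over the slab. There the temporal
and spatial lower bounds apply, and the last factor is the volume of the slab. -/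
theorem le_inner_slab_self {e c r : ℝ} (hf : HasLowerPower f e c)
    (hc : 0 ≤ c) (hr : 0 < r) (hr1 : r ≤ 1) {a b : ℝ≥0} (hab : a < b) :
    incrementConst H * ((b : ℝ) - a) ^ (2 * H.1 - 1) *
        (c * (2 * r) ^ e * volume.real (originBall d r).1) *
        (((b : ℝ) - a) * volume.real (originBall d r).1) ≤
      ⟪slab H f a b (originBall d r), slab H f a b (originBall d r)⟫_ℝ := by
  set A := originBall d r
  have hab' : (a : ℝ) < b := hab
  obtain ⟨hi, he⟩ := (isElement_slab (H := H) (f := f) hab.le A).inner_slab a b A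
  have hm : MeasurableSet (Set.Ioc (a : ℝ) b ×ˢ A.1) := measurableSet_Ioc.prod A.2.1
  have hsub : Set.Ioc (a : ℝ) b ×ˢ A.1 ⊆ Set.Ici 0 ×ˢ Set.univ :=
    Set.prod_mono (fun r hr => a.2.trans hr.1.le) (Set.subset_univ _)
  have hvol : (volume : Measure (ℝ × Space d)).real (Set.Ioc (a : ℝ) b ×ˢ A.1) =
      ((b : ℝ) - a) * volume.real A.1 := by
    rw [Measure.volume_eq_prod, measureReal_prod_prod, Real.volume_real_Ioc_of_le hab'.le]
  have hfin : (volume : Measure (ℝ × Space d)) (Set.Ioc (a : ℝ) b ×ˢ A.1) ≠ ∞ := by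
    rw [Measure.volume_eq_prod, Measure.prod_prod]
    exact ENNReal.mul_ne_top (by simp) measure_closedBall_lt_top.ne
  rw [indicator_one_mul_eq] at he hi
  rw [he, setIntegral_indicator hm, Set.inter_eq_self_of_subset_right hsub, ← hvol,
    mul_comm _ (Measure.real _ _), ← smul_eq_mul, ← setIntegral_const]
  have hi' : IntegrableOn (slabPotential H f a b A) (Set.Ioc (a : ℝ) b ×ˢ A.1) := by
    refine (hi.mono_set hsub).congr_fun (fun p hp => Set.indicator_of_mem hp _) hm
  refine setIntegral_mono_on (integrableOn_const hfin) hi' hm fun p hp => ?_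
  rw [slabPotential_eq_mul]
  exact mul_le_mul (le_timePotential_sub hab hp.1) (le_spacePotential hf hr hr1 hp.2)
    (by positivity) (sub_nonneg.2 (timePotential_mono hab.le _))

end Potential

/-! ### Lower bounds for the Riesz and Bessel kernels -/

theorem rieszKernel_nonneg {d : ℕ} {α : ℝ} (hα : 0 < α) (hd : α < d) (x : Space d) :
    0 ≤ (rieszKernel d α hα hd).toFun x := by
  have h1 : 0 < Real.Gamma ((d - α) / 2) := Real.Gamma_pos_of_pos (by linarith)
  have h2 : 0 < Real.Gamma (α / 2) := Real.Gamma_pos_of_pos (by linarith)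
  simp only [rieszKernel]
  positivity

theorem rieszKernel_hasLowerPower {d : ℕ} {α : ℝ} (hα : 0 < α) (hd : α < d) :
    ∃ c, 0 < c ∧ HasLowerPower (rieszKernel d α hα hd) (α - d) c := by
  have h1 : 0 < Real.Gamma ((d - α) / 2) := Real.Gamma_pos_of_pos (by linarith)
  have h2 : 0 < Real.Gamma (α / 2) := Real.Gamma_pos_of_pos (by linarith)
  have hd0 : 0 < d := by exact_mod_cast hα.trans hd
  have : NeZero d := ⟨hd0.ne'⟩
  refine ⟨Real.Gamma ((d - α) / 2) * 2 ^ (-α) * Real.pi ^ (-(d : ℝ) / 2) / Real.Gamma (α / 2),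
    by positivity, ?_⟩
  have hne : ∀ᵐ x : Space d, x ≠ 0 := by simp [ae_iff]
  filter_upwards [hne] with x hx ρ _ _ hxρ
  simp only [rieszKernel, neg_add_eq_sub]
  exact mul_le_mul_of_nonneg_left
    (Real.rpow_le_rpow_of_nonpos (norm_pos_iff.2 hx) hxρ (by linarith)) (by positivity)

theorem besselKernel_nonneg {d : ℕ} {α : ℝ} (hα : 0 < α) (x : Space d) :
    0 ≤ (besselKernel d α hα).toFun x := by
  have h2 : 0 < Real.Gamma (α / 2) := Real.Gamma_pos_of_pos (by linarith)
  simp only [besselKernel]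
  refine mul_nonneg (by positivity) (setIntegral_nonneg measurableSet_Ioi fun w hw => ?_)
  have hw : 0 < w := hw
  positivity

/-- The part w ∈ (ρ², 2ρ²] of the Gaussian mixture already suffices: with s = (α - d)/2 - 1 < 0, the
integrand there is at least a constant times ρ^{2s}, and the length ρ² of the interval turns this
into ρ^{α-d}. -/
theorem besselKernel_hasLowerPower {d : ℕ} {α : ℝ} (hα : 0 < α) (hd : α < d) :
    ∃ c, 0 < c ∧ HasLowerPower (besselKernel d α hα) (α - d) c := by
  have h2 : 0 < Real.Gamma (α / 2) := Real.Gamma_pos_of_pos (by linarith)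
  set s : ℝ := (α - d) / 2 - 1 with hs
  set k : ℝ := ((4 * Real.pi) ^ ((d : ℝ) / 2) * Real.Gamma (α / 2))⁻¹ with hk
  have hk0 : 0 < k := by positivity
  refine ⟨k * (2 ^ s * Real.exp (-8) * Real.exp (-(1 / 4))), by positivity, ?_⟩
  -- Discarding part of the integral requires integrability in w, which Fubini gives for almost
  -- every x.
  have hint := (integrable_bessel_prod (E := Space d) hα).prod_right_ae
  rw [finrank_euclideanSpace_fin] at hint
  filter_upwards [hint] with x hx ρ hρ hρ2 hxρ
  change _ ≤ k * ∫ w in Set.Ioi (0 : ℝ), w ^ s * Real.exp (-w) * Real.exp (-‖x‖ ^ 2 / (4 * w))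
  rw [mul_assoc k]
  refine mul_le_mul_of_nonneg_left ?_ hk0.le
  have hsub : Set.Ioc (ρ ^ 2) (2 * ρ ^ 2) ⊆ Set.Ioi 0 := fun w hw =>
    lt_trans (by positivity) hw.1
  have hx' : IntegrableOn (fun w : ℝ => w ^ s * Real.exp (-w) * Real.exp (-‖x‖ ^ 2 / (4 * w)))
      (Set.Ioi 0) := hx
  have hval : ∫ _ in Set.Ioc (ρ ^ 2) (2 * ρ ^ 2),
      (2 * ρ ^ 2) ^ s * Real.exp (-8) * Real.exp (-(1 / 4)) =
      2 ^ s * Real.exp (-8) * Real.exp (-(1 / 4)) * ρ ^ (α - d) := by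
    rw [setIntegral_const, Real.volume_real_Ioc_of_le (by nlinarith), smul_eq_mul,
      Real.mul_rpow zero_le_two (sq_nonneg ρ), show α - d = 2 + 2 * s by rw [hs]; ring,
      Real.rpow_add hρ, Real.rpow_mul hρ.le, Real.rpow_two]
    ring
  rw [← hval]
  refine (setIntegral_mono_on (integrableOn_const (by simp)) (hx'.mono_set hsub) measurableSet_Ioc
    fun w hw => ?_).trans (setIntegral_mono_set hx' ?_ (Filter.Eventually.of_forall hsub))
  · have hw0 : 0 < w := hsub hw
    have e1 : (2 * ρ ^ 2) ^ s ≤ w ^ s :=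
      Real.rpow_le_rpow_of_nonpos hw0 hw.2 (by rw [hs]; linarith)
    -- The constant 8 comes from w ≤ 2ρ² with ρ ≤ 2; the constant 1/4 below comes from |x|² ≤ ρ² <
    -- w.
    have e2 : Real.exp (-8) ≤ Real.exp (-w) := Real.exp_le_exp.2 (by nlinarith [hw.2])
    have e3 : Real.exp (-(1 / 4)) ≤ Real.exp (-‖x‖ ^ 2 / (4 * w)) := by
      refine Real.exp_le_exp.2 ?_
      rw [neg_div, neg_le_neg_iff, div_le_iff₀ (by positivity)]
      nlinarith [hw.1, norm_nonneg x]
    gcongr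
  · filter_upwards [ae_restrict_mem measurableSet_Ioi] with w hw
    have hw0 : 0 < w := hw
    simp only [Pi.zero_apply]
    positivity

/-! ### The heat kernel -/

theorem heatKernel_nonneg {d : ℕ} {t : ℝ} (ht : 0 ≤ t) (x : Space d) : 0 ≤ heatKernel t x := by
  rw [heatKernel]; positivity

theorem integral_heatKernel_sub {d : ℕ} {t : ℝ} (ht : 0 < t) (x : Space d) :
    ∫ y, heatKernel t (x - y) = 1 := by
  rw [integral_sub_left_eq_self (fun y => heatKernel t y) volume x]
  have h := GaussianFourier.integral_rexp_neg_mul_sq_norm (V := Space d) (b := 1 / (2 * t))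
    (by positivity)
  rw [finrank_euclideanSpace_fin] at h
  have e : ∀ y : Space d, heatKernel t y =
      (2 * Real.pi * t) ^ (-(d : ℝ) / 2) * Real.exp (-(1 / (2 * t)) * ‖y‖ ^ 2) := fun y => by
    rw [heatKernel]; congr 2; ring
  simp only [e]
  rw [integral_const_mul, h, show Real.pi / (1 / (2 * t)) = 2 * Real.pi * t by field_simp,
    ← Real.rpow_add (by positivity)]
  ring_nf
  simp

theorem heatSemigroup_one {d : ℕ} {t : ℝ} (ht : 0 ≤ t) (x : Space d) :
    heatSemigroup t (fun _ => 1) x = 1 := by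
  rw [heatSemigroup]
  split_ifs with h
  · rfl
  · simpa using integral_heatKernel_sub (lt_of_le_of_ne ht (Ne.symm h)) x

/-- Lower bound for the heat kernel in a parabolic region. -/
theorem le_heatKernel {d : ℕ} {r t : ℝ} (hr : 0 < r) (h1 : r ^ 2 ≤ t) (h2 : t ≤ 2 * r ^ 2)
    {y : Space d} (hy : ‖y‖ ≤ r) :
    (4 * Real.pi) ^ (-(d : ℝ) / 2) * Real.exp (-(1 / 2)) * r⁻¹ ^ d ≤ heatKernel t y := by
  have ht : 0 < t := lt_of_lt_of_le (by positivity) h1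
  have e : (4 * Real.pi * r ^ 2) ^ (-(d : ℝ) / 2) =
      (4 * Real.pi) ^ (-(d : ℝ) / 2) * r⁻¹ ^ d := by
    rw [Real.mul_rpow (by positivity) (by positivity), ← Real.rpow_natCast r 2,
      ← Real.rpow_mul hr.le, ← Real.rpow_natCast r⁻¹, Real.inv_rpow hr.le, ← Real.rpow_neg hr.le]
    congr 2
    push_cast; ring
  rw [mul_right_comm, ← e, heatKernel]
  gcongr ?_ * ?_
  · refine Real.rpow_le_rpow_of_nonpos (by positivity) ?_ ?_
    · nlinarith [Real.pi_pos]
    · rw [neg_div]; exact neg_nonpos.2 (by positivity)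
  · refine Real.exp_le_exp.2 ?_
    rw [neg_div, neg_le_neg_iff, div_le_iff₀ (by positivity)]
    nlinarith [norm_nonneg y]

/-! ### The mean of a solution -/

section Mean

variable {d : ℕ} {H : Hurst} {f : CovKernel d} {Ω : Type*} [MeasurableSpace Ω]
  {W : HP H f → Ω → ℝ} {P : Measure Ω} [IsProbabilityMeasure P]

/-- A constant is a cylindrical variable depending on no Gaussian coordinate (n = 0), so its
derivative is an empty sum. -/
theorem one_zero_mem_malliavinGraph :
    ((Lp.const 2 P (1 : ℝ), 0) : Lp ℝ 2 P × Lp (HP H f) 2 P) ∈ malliavinGraph W P := by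
  refine subset_closure ⟨0, fun _ => 1, Fin.elim0, ⟨contDiff_const, fun k => ?_⟩, ?_, ?_⟩
  · rcases k with _ | k
    · exact ⟨1, fun x => by simp⟩
    · exact ⟨0, fun x => by simp [iteratedFDeriv_succ_const]⟩
  · exact Lp.coeFn_const 2 P (1 : ℝ)
  · filter_upwards [Lp.coeFn_zero (HP H f) 2 P] with ω hω
    rw [hω]
    simp

theorem IsSkorohodIntegral.integral_eq_zero {Z : Ω → HP H f} {G : Ω → ℝ}
    (h : IsSkorohodIntegral W P Z G) : ∫ ω, G ω ∂P = 0 := by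
  have h1 := h.duality _ one_zero_mem_malliavinGraph
  have e1 : ∫ ω, (Lp.const 2 P (1 : ℝ)) ω * G ω ∂P = ∫ ω, G ω ∂P := by
    refine integral_congr_ae ?_
    filter_upwards [Lp.coeFn_const 2 P (1 : ℝ)] with ω hω
    rw [hω]
    simp
  have e2 : ∫ ω, ⟪(0 : Lp (HP H f) 2 P) ω, Z ω⟫_ℝ ∂P = 0 := by
    refine integral_eq_zero_of_ae ?_
    filter_upwards [Lp.coeFn_zero (HP H f) 2 P] with ω hω
    rw [hω]
    simp
  exact e1.symm.trans (h1.trans e2)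

theorem IsHeatSolution.integral_eq_one {u : ℝ → Space d → Ω → ℝ}
    (hu : IsHeatSolution W P (fun _ => 1) u) {t : ℝ} (ht : 0 ≤ t) (x : Space d) :
    ∫ ω, u t x ω ∂P = 1 := by
  obtain ⟨G, ⟨Z, -, hZ⟩, hG⟩ := hu.mild t ht x
  rw [integral_congr_ae hG, integral_add (integrable_const _)
    (hZ.memLp_integral.integrable one_le_two), hZ.integral_eq_zero, heatSemigroup_one ht]
  simp

/-- The heat kernel belongs to the Hilbert space as soon as there is a solution. -/
theorem IsHeatSolution.exists_isElement {u : ℝ → Space d → Ω → ℝ}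
    (hu : IsHeatSolution W P (fun _ => 1) u) {t : ℝ} (ht : 0 ≤ t) (x : Space d) :
    ∃ h : HP H f, IsElement
      (fun p => (Set.Icc 0 t).indicator (fun s => heatKernel (t - s) (x - p.2)) p.1) h := by
  obtain ⟨G, ⟨Z, hY, -⟩, -⟩ := hu.mild t ht x
  -- The sure event gives the expectation of the field, p_{t-s}(x - y) E u_{s,y}, and the mean of u
  -- is 1.
  refine ⟨_, (hY Set.univ MeasurableSet.univ).congr fun p hp => ?_⟩
  by_cases hpt : p.1 ∈ Set.Icc 0 t
  · simp only [Set.indicator_of_mem hpt, Measure.restrict_univ, integral_const_mul,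
      hu.integral_eq_one hp, mul_one]
  · simp [Set.indicator_of_notMem hpt]

end Mean

/-! ### Divergence along dyadic slabs -/

/-- Otherwise all partial sums Ψ satisfy ‖Ψ‖² ≤ C⟨h, Ψ⟩, so their norms are at most C‖h‖, whereas
nonnegative cross terms make ‖Ψ‖² grow at least linearly in N. -/
theorem exists_inner_sum_gt {F : Type*} [NormedAddCommGroup F] [InnerProductSpace ℝ F] (h : F)
    (e : ℕ → F) {δ C : ℝ} (hδ : 0 < δ) (hC : 0 ≤ C) (hnn : ∀ i j, 0 ≤ ⟪e i, e j⟫_ℝ)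
    (hself : ∀ i, δ ≤ ⟪e i, e i⟫_ℝ) :
    ∃ N l, C * ⟪h, e l⟫_ℝ < ⟪∑ k ∈ Finset.range N, e k, e l⟫_ℝ := by
  by_contra! hle
  obtain ⟨N, hN⟩ := exists_nat_gt ((C * ‖h‖) ^ 2 / δ)
  rw [div_lt_iff₀ hδ] at hN
  set Ψ := ∑ k ∈ Finset.range N, e k with hΨ
  have h1 : ‖Ψ‖ ^ 2 ≤ C * ⟪h, Ψ⟫_ℝ := by
    rw [← real_inner_self_eq_norm_sq]
    nth_rewrite 2 [hΨ]
    rw [inner_sum]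
    nth_rewrite 2 [hΨ]
    rw [inner_sum, Finset.mul_sum]
    exact Finset.sum_le_sum fun l _ => hle N l
  have h2 : C * ⟪h, Ψ⟫_ℝ ≤ C * ‖h‖ * ‖Ψ‖ := by
    rw [mul_assoc]
    exact mul_le_mul_of_nonneg_left (real_inner_le_norm h Ψ) hC
  have h3 : N * δ ≤ ‖Ψ‖ ^ 2 := by
    rw [← real_inner_self_eq_norm_sq, hΨ, inner_sum]
    have h4 : ∑ _ ∈ Finset.range N, δ = N * δ := by simp
    rw [← h4]
    refine Finset.sum_le_sum fun l hl => ?_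
    rw [sum_inner]
    exact (hself l).trans (Finset.single_le_sum (f := fun k => ⟪e k, e l⟫_ℝ)
      (fun k _ => hnn k l) hl)
  -- With q = C‖h‖, the bound ‖Ψ‖² ≤ q‖Ψ‖ and 2q‖Ψ‖ ≤ q² + ‖Ψ‖² give ‖Ψ‖² ≤ q² < Nδ ≤ ‖Ψ‖².
  nlinarith [sq_nonneg (‖Ψ‖ - C * ‖h‖), sq_nonneg (‖Ψ‖ + C * ‖h‖), norm_nonneg Ψ]

/-- The spatial scales `2^{-(k+1)}`. -/
noncomputable def scale (k : ℕ) : ℝ := (1 / 2) ^ (k + 1)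

theorem scale_pos (k : ℕ) : 0 < scale k := by rw [scale]; positivity

/-- The cap 1/2 keeps the slab endpoints nonnegative and the radii at most 1. -/
theorem scale_le (k : ℕ) : scale k ≤ 1 / 2 := by
  rw [scale, pow_succ]
  exact mul_le_of_le_one_left (by norm_num) (pow_le_one₀ (by norm_num) (by norm_num))

theorem scale_le_half {j k : ℕ} (h : j < k) : scale k ≤ scale j / 2 := by
  have : scale j / 2 = (1 / 2) ^ (j + 2) := by rw [scale]; ring
  rw [this, scale]
  exact pow_le_pow_of_le_one (by norm_num) (by norm_num) (by omega)

/-- The beginning of the time interval at scale `k`. -/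
noncomputable def slabStart (k : ℕ) : ℝ≥0 :=
  ⟨1 - 2 * scale k ^ 2, by nlinarith [scale_pos k, scale_le k]⟩

/-- The end of the time interval at scale `k`. -/
noncomputable def slabEnd (k : ℕ) : ℝ≥0 :=
  ⟨1 - scale k ^ 2, by nlinarith [scale_pos k, scale_le k]⟩

theorem coe_slabStart (k : ℕ) : (slabStart k : ℝ) = 1 - 2 * scale k ^ 2 := rfl

theorem coe_slabEnd (k : ℕ) : (slabEnd k : ℝ) = 1 - scale k ^ 2 := rfl

theorem slabStart_lt_slabEnd (k : ℕ) : slabStart k < slabEnd k := by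
  rw [← NNReal.coe_lt_coe, coe_slabStart, coe_slabEnd]
  nlinarith [scale_pos k]

/-- Halving the spatial scale divides the time scale by 4, more than the ratio 2 between the two
ends of a slab; hence slabs at different scales are disjoint. -/
theorem slabEnd_le_slabStart {j k : ℕ} (h : j < k) : (slabEnd j : ℝ) ≤ slabStart k := by
  rw [coe_slabStart, coe_slabEnd]
  nlinarith [scale_pos k, scale_le_half h]

/-! ### Parabolic regions under the heat kernel -/

section Divergence

variable {d : ℕ}

/-- The region at scale `k`. -/
noncomputable def slabRegion (d k : ℕ) : Set (ℝ × Space d) :=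
  Set.Ioc (slabStart k : ℝ) (slabEnd k) ×ˢ (originBall d (scale k)).1

theorem eq_of_mem_slabRegion {j k : ℕ} {p : ℝ × Space d} (hj : p ∈ slabRegion d j)
    (hk : p ∈ slabRegion d k) : j = k := by
  by_contra hne
  rcases lt_or_gt_of_ne hne with h | h
  · linarith [slabEnd_le_slabStart h, hj.1.2, hk.1.1]
  · linarith [slabEnd_le_slabStart h, hk.1.2, hj.1.1]

/-- By disjointness at most one term is nonzero at a given point, so the bound of `le_heatKernel` at
a single scale controls the whole sum. -/
theorem sum_indicator_le_heatKernel (S : Finset ℕ) (p : ℝ × Space d) :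
    (4 * Real.pi) ^ (-(d : ℝ) / 2) * Real.exp (-(1 / 2)) *
        ∑ k ∈ S, (scale k)⁻¹ ^ d * (slabRegion d k).indicator (fun _ => 1) p ≤
      (Set.Icc 0 1).indicator (fun s => heatKernel (1 - s) (0 - p.2)) p.1 := by
  by_cases hp : ∃ k ∈ S, p ∈ slabRegion d k
  · obtain ⟨k, hkS, hk⟩ := hp
    rw [Finset.sum_eq_single_of_mem k hkS fun j _ hj => by
      rw [Set.indicator_of_notMem fun h => hj (eq_of_mem_slabRegion h hk), mul_zero],
      Set.indicator_of_mem hk, mul_one]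
    obtain ⟨⟨h1, h2⟩, h3⟩ := hk
    rw [coe_slabStart] at h1
    rw [coe_slabEnd] at h2
    have h4 := scale_pos k
    have h5 := scale_le k
    rw [Set.indicator_of_mem (by constructor <;> nlinarith)]
    refine le_heatKernel h4 (by linarith) (by linarith) ?_
    simpa [originBall] using h3
  · push Not at hp
    rw [Finset.sum_eq_zero fun k hk => by rw [Set.indicator_of_notMem (hp k hk), mul_zero],
      mul_zero]
    exact Set.indicator_nonneg (fun s hs => heatKernel_nonneg (by linarith [hs.2]) _) _

variable {H : Hurst} {f : CovKernel d}

theorem le_inner_scaled_slab {e c : ℝ} (hf : HasLowerPower f e c) (hc : 0 ≤ c)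
    (he : 4 * H.1 + e ≤ 0) (k : ℕ) :
    incrementConst H * c * 2 ^ e * volume.real (Metric.ball (0 : Space d) 1) ^ 2 ≤
      ⟪(scale k)⁻¹ ^ d • slab H f (slabStart k) (slabEnd k) (originBall d (scale k)),
        (scale k)⁻¹ ^ d • slab H f (slabStart k) (slabEnd k) (originBall d (scale k))⟫_ℝ := by
  have hr := scale_pos k
  have hr1 : scale k ≤ 1 := (scale_le k).trans (by norm_num)
  have h := le_inner_slab_self (H := H) hf hc hr hr1 (slabStart_lt_slabEnd k)
  have hK := incrementConst_pos H
  have hV : volume.real (originBall d (scale k)).1 =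
      scale k ^ d * volume.real (Metric.ball (0 : Space d) 1) := by
    have := Measure.addHaar_real_closedBall (volume : Measure (Space d)) 0 hr.le
    rwa [finrank_euclideanSpace_fin] at this
  rw [coe_slabStart, coe_slabEnd,
    show 1 - scale k ^ 2 - (1 - 2 * scale k ^ 2) = scale k ^ 2 by ring, hV] at h
  rw [real_inner_smul_left, real_inner_smul_right]
  refine le_trans ?_ (mul_le_mul_of_nonneg_left (mul_le_mul_of_nonneg_left h
    (by positivity)) (by positivity))
  generalize scale k = r at *
  generalize volume.real (Metric.ball (0 : Space d) 1) = V
  -- The normalisation r^{-2d} cancels the two ball volumes. What remains is r^{2(2H-1)+e+2} =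
  -- r^{4H+e}, at least 1 since r ≤ 1 and 4H + e ≤ 0.
  have hp : (1 : ℝ) ≤ (r ^ 2) ^ (2 * H.1 - 1) * r ^ e * r ^ 2 := by
    have e1 : (r ^ 2) ^ (2 * H.1 - 1) * r ^ e * r ^ 2 = r ^ (4 * H.1 + e) := by
      rw [← Real.rpow_two, ← Real.rpow_mul hr.le, ← Real.rpow_add hr, ← Real.rpow_add hr]
      congr 1; ring
    rw [e1]
    exact Real.one_le_rpow_of_pos_of_le_one_of_nonpos hr hr1 he
  have hrd : r⁻¹ ^ d * r ^ d = 1 := by rw [← mul_pow, inv_mul_cancel₀ hr.ne', one_pow]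
  rw [Real.mul_rpow zero_le_two hr.le]
  calc incrementConst H * c * 2 ^ e * V ^ 2
      ≤ incrementConst H * c * 2 ^ e * V ^ 2 *
        ((r ^ 2) ^ (2 * H.1 - 1) * r ^ e * r ^ 2) :=
        le_mul_of_one_le_right (by positivity) hp
    _ = incrementConst H * c * 2 ^ e * V ^ 2 *
        ((r ^ 2) ^ (2 * H.1 - 1) * r ^ e * r ^ 2) * ((r⁻¹ ^ d * r ^ d) * (r⁻¹ ^ d * r ^ d)) := by
        rw [hrd]; ring
    _ = _ := by ring

/-- If the heat kernel belongs to the Hilbert space, then the spatial kernel is not too singular. -/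
theorem pos_of_isElement_heatKernel {e c : ℝ} (hf0 : ∀ x, 0 ≤ f.toFun x)
    (hf : HasLowerPower f e c) (hc : 0 < c) {h : HP H f}
    (hh : IsElement (fun p : ℝ × Space d =>
      (Set.Icc 0 1).indicator (fun s => heatKernel (1 - s) (0 - p.2)) p.1) h) :
    0 < 4 * H.1 + e := by
  by_contra! he
  set κ : ℝ := (4 * Real.pi) ^ (-(d : ℝ) / 2) * Real.exp (-(1 / 2)) with hκ
  have hκ0 : 0 < κ := by positivity
  have hV : 0 < volume.real (Metric.ball (0 : Space d) 1) :=
    ENNReal.toReal_pos (Metric.measure_ball_pos _ _ one_pos).ne' measure_ball_lt_top.ne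
  have hK := incrementConst_pos H
  set E : ℕ → HP H f := fun k =>
    (scale k)⁻¹ ^ d • slab H f (slabStart k) (slabEnd k) (originBall d (scale k)) with hE
  have hel : ∀ k, IsElement
      (fun p => (scale k)⁻¹ ^ d * (slabRegion d k).indicator (fun _ => 1) p) (E k) := fun k =>
    (isElement_slab (slabStart_lt_slabEnd k).le _).const_smul _
  have hnn : ∀ i j, 0 ≤ ⟪E i, E j⟫_ℝ := fun i j => by
    simp only [hE, real_inner_smul_left, real_inner_smul_right]
    have h1 := scale_pos i
    have h2 := scale_pos j
    have := inner_slab_slab_nonneg (H := H) hf0 (slabStart_lt_slabEnd i).le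
      (slabStart_lt_slabEnd j).le (originBall d (scale i)) (originBall d (scale j))
    positivity
  obtain ⟨N, l, hlt⟩ := exists_inner_sum_gt h E (C := κ⁻¹)
    (δ := incrementConst H * c * 2 ^ e * volume.real (Metric.ball (0 : Space d) 1) ^ 2)
    (by positivity) (by positivity) hnn (le_inner_scaled_slab hf hc.le he)
  have hle := IsElement.inner_slab_le hf0
    ((IsElement.sum (Finset.range N) hel).const_smul κ) hh
    (fun p _ => sum_indicator_le_heatKernel (Finset.range N) p) (slabStart_lt_slabEnd l).le
    (originBall d (scale l))
  refine not_le.2 hlt ?_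
  -- The choice C = κ⁻¹ makes the comparison with the heat kernel contradict `hlt`, once the test
  -- slab is rescaled by r^{-d}.
  rw [inv_mul_eq_div, le_div_iff₀ hκ0, mul_comm, ← real_inner_smul_left]
  simp only [hE, real_inner_smul_right] at hle ⊢
  exact mul_le_mul_of_nonneg_left hle (pow_nonneg (inv_nonneg.2 (scale_pos l).le) d)

end Divergence

end FracHeat

/-! ### The necessary condition on the Hurst index -/

open FracHeat
theorem proposition3 {d : ℕ} (H : Hurst) {α : ℝ} (hα : 0 < α) (f : CovKernel d)
    (hf : (∃ hd : α < d, f = rieszKernel d α hα hd) ∨ f = besselKernel d α hα)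
    {Ω : Type*} [MeasurableSpace Ω] (P : Measure Ω) [IsProbabilityMeasure P]
    (W : HP H f → Ω → ℝ) (hW : IsNoise W P)
    (hsol : ∃ u : ℝ → Space d → Ω → ℝ, IsHeatSolution W P (fun _ => 1) u) :
    ((d : ℝ) - α) / 4 < H.1 := by
  obtain ⟨u, hu⟩ := hsol
  obtain ⟨h, hh⟩ := hu.exists_isElement zero_le_one 0
  -- If α ≥ d, possible only for the Bessel kernel, the claim is trivial as H > 0; the lower power
  -- bound needs α < d.
  rcases le_or_gt (d : ℝ) α with hdα | hd
  · linarith [H.2.1]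
  have key : (∀ x, 0 ≤ f.toFun x) ∧ ∃ c, 0 < c ∧ HasLowerPower f (α - d) c := by
    rcases hf with ⟨hd', rfl⟩ | rfl
    · exact ⟨rieszKernel_nonneg hα hd', rieszKernel_hasLowerPower hα hd'⟩
    · exact ⟨besselKernel_nonneg hα, besselKernel_hasLowerPower hα hd⟩
  obtain ⟨hf0, c, hc, hfc⟩ := key
  linarith [pos_of_isElement_heatKernel hf0 hfc hc hh]
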